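/- Let $n\ge 1$, let $\|\cdot\|$ be the operator norm on $\mathbb{C}^{n\times n}$ induced by the Euclidean norm, and call $A=UTU^*$ a Schur factorization of $A\in\mathbb{C}^{n\times n}$ if $U\in\mathbb{C}^{n\times n}$ is unitary and $T\in\mathbb{C}^{n\times n}$ is upper triangular. Let $A_0\in\mathbb{C}^{n\times n}$ be non-derogatory, i.e. the Jordan form of $A_0$ has only one Jordan block for each eigenvalue. Then there exist constants $K,\varepsilon>0$, depending only on $A_0$, such that for every Schur factorization $A_0=U_0T_0U_0^*$ and every $A\in\mathbb{C}^{n\times n}$ with $\|A-A_0\|<\varepsilon$ there exists a Schur factorization $A=UTU^*$ such that $$\|U-U_0\|+\|T-T_0\|\le K\|A-A_0\|^{1/n}.$$ -/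

import Mathlib

open scoped Matrix Matrix.Norms.L2Operator

/-- The `m × m` Jordan block with eigenvalue `μ`: `μ` on the diagonal and `1` on the
superdiagonal. -/
def jordanBlock (m : ℕ) (μ : ℂ) : Matrix (Fin m) (Fin m) ℂ :=
  Matrix.of fun i j => if i = j then μ else if (i : ℕ) + 1 = (j : ℕ) then 1 else 0

/-- The Jordan matrix: direct sum of the Jordan blocks of sizes `m i` with eigenvalues `μ i`. -/
def jordanMatrix {r : ℕ} (m : Fin r → ℕ) (μ : Fin r → ℂ) :
    Matrix (Σ i, Fin (m i)) (Σ i, Fin (m i)) ℂ :=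
  Matrix.blockDiagonal' fun i => jordanBlock (m i) (μ i)

/-- `A` has a Jordan canonical form with (nonempty) blocks of sizes `m i` and eigenvalues `μ i`:
it is similar to that Jordan matrix, its rows and columns being listed by `Fin n` through `e`. -/
def HasJordanForm {n r : ℕ} (A : Matrix (Fin n) (Fin n) ℂ) (m : Fin r → ℕ) (μ : Fin r → ℂ) :
    Prop :=
  (∀ i, 0 < m i) ∧
    ∃ (e : (Σ i, Fin (m i)) ≃ Fin n) (P : Matrix (Fin n) (Fin n) ℂ),
      IsUnit P.det ∧ A = P * Matrix.reindex e e (jordanMatrix m μ) * P⁻¹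

/-- A complex square matrix is non-derogatory if its Jordan canonical form has only one Jordan
block per eigenvalue, that is, distinct blocks have distinct eigenvalues. -/
def IsNonderogatory {n : ℕ} (A : Matrix (Fin n) (Fin n) ℂ) : Prop :=
  ∃ (r : ℕ) (m : Fin r → ℕ) (μ : Fin r → ℂ), HasJordanForm A m μ ∧ Function.Injective μ

/-- `A = U T U^*` is a Schur decomposition: `U` is unitary and `T` is upper triangular. -/
structure IsSchurDecomposition {n : ℕ} (A U T : Matrix (Fin n) (Fin n) ℂ) : Prop where
  unitary : U ∈ Matrix.unitaryGroup (Fin n) ℂ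
  upperTriangular : T.IsUpperTriangular
  eq : A = U * T * Uᴴ

/-! The exponent `1/n` comes from the eigenvalues alone; once these are matched in order, the Schur
vectors move Lipschitz continuously.

Eigenvalues: at an eigenvalue of `A`, the characteristic polynomial of `A₀` is `O(‖A - A₀‖)`. It is
a product of `n` distances to eigenvalues of `A₀`, so one of them is `O(‖A - A₀‖^(1/n))`. A
continuity argument turns this into a matching with multiplicities (`exists_eigenvalue_matching`).

Vectors: let `s` be the diagonal of `T₀`, `l` the matched eigenvalues of `A`, and `V` the unitary
factor of a Schur decomposition of `A` in the order `l`. The first `k` columns of `V` are killed by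
`N = (A - l 0) ⋯ (A - l (k - 1))`. Since `A₀` is non-derogatory, each factor of `M = (A₀ - s 0) ⋯
(A₀ - s (k - 1))` has kernel of dimension at most one, so `ker M` is exactly the span of the first
`k` columns of `U₀`. If `M G M = M` and `N v = 0`, then `v - G (M - N) v = v - G M v` lies in `ker
M`; hence `U₀ᴴ V` is upper triangular up to `O(‖M - N‖)`. A nearly triangular unitary matrix is
nearly diagonal, and rescaling the columns of `V` by phases brings it close to `U₀`. `G` depends
only on `A₀` and `s`, and there are finitely many orderings `s`, so the constants are uniform in
`U₀`. -/

/-! ### Jordan form and eigenspaces of dimension at most one -/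

theorem jordanMatrix_mulVec_apply {r : ℕ} (m : Fin r → ℕ) (μ : Fin r → ℂ)
    (y : (Σ i, Fin (m i)) → ℂ) (i : Fin r) (a : Fin (m i)) :
    (jordanMatrix m μ *ᵥ y) ⟨i, a⟩ =
      μ i * y ⟨i, a⟩ + if h : (a : ℕ) + 1 < m i then y ⟨i, ⟨a + 1, h⟩⟩ else 0 := by
  have h1 : (jordanMatrix m μ *ᵥ y) ⟨i, a⟩ = ∑ b, jordanBlock (m i) (μ i) a b * y ⟨i, b⟩ := by
    simp only [Matrix.mulVec, dotProduct, jordanMatrix, Fintype.sum_sigma]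
    rw [Finset.sum_eq_single i]
    · simp [Matrix.blockDiagonal'_apply_eq]
    · intro k _ hk
      refine Finset.sum_eq_zero fun b _ => ?_
      rw [Matrix.blockDiagonal'_apply_ne _ _ _ (Ne.symm hk), zero_mul]
    · simp
  have h2 : ∀ b, jordanBlock (m i) (μ i) a b * y ⟨i, b⟩ =
      (if a = b then μ i * y ⟨i, b⟩ else 0) +
        (if (a : ℕ) + 1 = (b : ℕ) then y ⟨i, b⟩ else 0) := by
    intro b
    simp only [jordanBlock, Matrix.of_apply]
    by_cases hab : a = b
    · subst hab; simp
    · by_cases h : (a : ℕ) + 1 = (b : ℕ) <;> simp [hab, h]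
  rw [h1, Finset.sum_congr rfl fun b _ => h2 b, Finset.sum_add_distrib]
  congr 1
  · simp
  · split_ifs with h
    · rw [Finset.sum_eq_single ⟨a + 1, h⟩]
      · simp
      · intro b _ hb
        rw [if_neg]
        intro h'
        exact hb (Fin.ext h'.symm)
      · simp
    · refine Finset.sum_eq_zero fun b _ => if_neg ?_
      have := b.2
      omega

/-- In a block with eigenvalue `ν` the eigenvector equation makes every coordinate after the first
vanish; in any other block, back substitution from the last coordinate kills everything. -/
theorem jordanMatrix_eigenvector_eq_zero {r : ℕ} {m : Fin r → ℕ} {μ : Fin r → ℂ}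
    {ν : ℂ} {y : (Σ i, Fin (m i)) → ℂ}
    (hy : jordanMatrix m μ *ᵥ y = ν • y)
    (h0 : ∀ (i : Fin r) (h : 0 < m i), μ i = ν → y ⟨i, ⟨0, h⟩⟩ = 0) : y = 0 := by
  have key : ∀ (i : Fin r) (a : Fin (m i)), μ i * y ⟨i, a⟩ +
      (if h : (a : ℕ) + 1 < m i then y ⟨i, ⟨a + 1, h⟩⟩ else 0) = ν * y ⟨i, a⟩ := by
    intro i a
    rw [← jordanMatrix_mulVec_apply, hy]; rfl
  funext ⟨i, a⟩
  by_cases hi : μ i = ν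
  · obtain ⟨a, ha⟩ := a
    cases a with
    | zero => exact h0 i ha hi
    | succ a =>
      have := key i ⟨a, by omega⟩
      simpa [hi, ha] using this
  · have : ∀ d : ℕ, ∀ a : Fin (m i), (a : ℕ) + d + 1 = m i → y ⟨i, a⟩ = 0 := by
      intro d
      induction d with
      | zero =>
        intro a ha
        have h := key i a
        rw [dif_neg (by omega), add_zero] at h
        have : (μ i - ν) * y ⟨i, a⟩ = 0 := by linear_combination h
        exact (mul_eq_zero.1 this).resolve_left (sub_ne_zero.2 hi)
      | succ d ih =>
        intro a ha
        have h := key i a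
        rw [dif_pos (by omega), ih ⟨a + 1, by omega⟩ (by simp; omega), add_zero] at h
        have : (μ i - ν) * y ⟨i, a⟩ = 0 := by linear_combination h
        exact (mul_eq_zero.1 this).resolve_left (sub_ne_zero.2 hi)
    exact this (m i - 1 - a) a (by have := a.2; omega)

theorem IsNonderogatory.finrank_ker_le_one {n : ℕ} {A : Matrix (Fin n) (Fin n) ℂ}
    (hA : IsNonderogatory A) (ν : ℂ) :
    Module.finrank ℂ (LinearMap.ker (A - ν • (1 : Matrix (Fin n) (Fin n) ℂ)).mulVecLin) ≤ 1 := by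
  obtain ⟨r, m, μ, ⟨hm, e, P, hP, hAP⟩, hμ⟩ := hA
  have hev : ∀ x : Fin n → ℂ, (A - ν • (1 : Matrix (Fin n) (Fin n) ℂ)) *ᵥ x = 0 →
      jordanMatrix m μ *ᵥ ((P⁻¹ *ᵥ x) ∘ e) = ν • ((P⁻¹ *ᵥ x) ∘ e) := by
    intro x hx
    have h1 : A *ᵥ x = ν • x := by
      rw [Matrix.sub_mulVec, Matrix.smul_mulVec, Matrix.one_mulVec, sub_eq_zero] at hx
      exact hx
    have h2 : (Matrix.reindex e e (jordanMatrix m μ)) *ᵥ (P⁻¹ *ᵥ x) = ν • (P⁻¹ *ᵥ x) := by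
      rw [← Matrix.mulVec_smul, ← h1, hAP, Matrix.mulVec_mulVec, Matrix.mulVec_mulVec,
        mul_assoc, Matrix.nonsing_inv_mul_cancel_left _ _ hP]
    rw [Matrix.reindex_apply, Matrix.submatrix_mulVec_equiv] at h2
    funext p
    have := congrFun h2 (e p)
    simpa using this
  have hzero : ∀ x : Fin n → ℂ, (P⁻¹ *ᵥ x) ∘ e = 0 → x = 0 := by
    intro x hx
    have h1 : P⁻¹ *ᵥ x = 0 := by
      funext i
      have := congrFun hx (e.symm i)
      simpa using this
    calc x = P *ᵥ (P⁻¹ *ᵥ x) := by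
          rw [Matrix.mulVec_mulVec, Matrix.mul_nonsing_inv _ hP, Matrix.one_mulVec]
      _ = 0 := by rw [h1, Matrix.mulVec_zero]
  by_cases hν : ∃ i, μ i = ν
  · obtain ⟨i₀, hi₀⟩ := hν
    -- Only block `i₀` has eigenvalue `ν`, so its first coordinate determines the eigenvector.
    let φ : (Fin n → ℂ) →ₗ[ℂ] ℂ := LinearMap.proj (e ⟨i₀, ⟨0, hm i₀⟩⟩) ∘ₗ (P⁻¹).mulVecLin
    have hinj : Function.Injective
        (φ.domRestrict (LinearMap.ker (A - ν • (1 : Matrix (Fin n) (Fin n) ℂ)).mulVecLin)) := by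
      rw [injective_iff_map_eq_zero]
      rintro ⟨x, hx⟩ hφ
      have hx' : (A - ν • (1 : Matrix (Fin n) (Fin n) ℂ)) *ᵥ x = 0 := hx
      have hφ' : (P⁻¹ *ᵥ x) (e ⟨i₀, ⟨0, hm i₀⟩⟩) = 0 := hφ
      refine Subtype.ext (hzero x (jordanMatrix_eigenvector_eq_zero (hev x hx') ?_))
      intro i h hi
      obtain rfl : i = i₀ := hμ (hi.trans hi₀.symm)
      exact hφ'
    simpa using LinearMap.finrank_le_finrank_of_injective hinj
  · rw [(LinearMap.ker_eq_bot'.2 fun x hx => hzero x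
      (jordanMatrix_eigenvector_eq_zero (hev x hx) fun i _ hi => (hν ⟨i, hi⟩).elim))]
    simp

/-! ### Kernels of shifted products -/

/-- The product `(A - l 0) (A - l 1) ⋯ (A - l (k - 1))`. -/
def shiftProd {n : ℕ} (A : Matrix (Fin n) (Fin n) ℂ) (l : ℕ → ℂ) : ℕ → Matrix (Fin n) (Fin n) ℂ
  | 0 => 1
  | k + 1 => shiftProd A l k * (A - l k • (1 : Matrix (Fin n) (Fin n) ℂ))

theorem finrank_ker_comp_le {V : Type*} [AddCommGroup V] [Module ℂ V] [FiniteDimensional ℂ V]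
    (f g : V →ₗ[ℂ] V) :
    Module.finrank ℂ (LinearMap.ker (f ∘ₗ g)) ≤
      Module.finrank ℂ (LinearMap.ker f) + Module.finrank ℂ (LinearMap.ker g) := by
  have h := LinearMap.finrank_range_add_finrank_ker (g.domRestrict (LinearMap.ker (f ∘ₗ g)))
  have h1 : LinearMap.range (g.domRestrict (LinearMap.ker (f ∘ₗ g))) ≤ LinearMap.ker f := by
    rintro _ ⟨⟨x, hx⟩, rfl⟩
    exact hx
  have h2 : Module.finrank ℂ (LinearMap.ker (g.domRestrict (LinearMap.ker (f ∘ₗ g)))) ≤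
      Module.finrank ℂ (LinearMap.ker g) := by
    let j : LinearMap.ker (g.domRestrict (LinearMap.ker (f ∘ₗ g))) →ₗ[ℂ] LinearMap.ker g :=
      ((LinearMap.ker (f ∘ₗ g)).subtype ∘ₗ Submodule.subtype _).codRestrict _ fun x => x.2
    refine LinearMap.finrank_le_finrank_of_injective (f := j) fun x y hxy => ?_
    have h4 : (j x : V) = j y := by rw [hxy]
    exact Subtype.ext (Subtype.ext h4)
  have h3 := Submodule.finrank_mono h1
  omega

theorem IsNonderogatory.finrank_ker_shiftProd_le {n : ℕ} {A : Matrix (Fin n) (Fin n) ℂ}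
    (hA : IsNonderogatory A) (l : ℕ → ℂ) (k : ℕ) :
    Module.finrank ℂ (LinearMap.ker (shiftProd A l k).mulVecLin) ≤ k := by
  induction k with
  | zero =>
    rw [shiftProd, Matrix.mulVecLin_one, LinearMap.ker_id]
    simp
  | succ k ih =>
    rw [shiftProd, Matrix.mulVecLin_mul]
    exact (finrank_ker_comp_le _ _).trans (add_le_add ih (hA.finrank_ker_le_one _))

/-- A generalized inverse: `y - G M y` always lies in `ker M`, which gives a correction into the
kernel with a bound independent of `y`. -/
theorem Matrix.exists_mul_mul_eq_self {n : ℕ} (M : Matrix (Fin n) (Fin n) ℂ) :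
    ∃ G : Matrix (Fin n) (Fin n) ℂ, M * G * M = M := by
  set f := M.mulVecLin
  obtain ⟨g, hg⟩ := f.rangeRestrict.exists_rightInverse_of_surjective f.range_rangeRestrict
  obtain ⟨g', hg'⟩ := LinearMap.exists_extend g
  refine ⟨LinearMap.toMatrix' g', ?_⟩
  apply Matrix.toLin'.injective
  rw [Matrix.toLin'_mul, Matrix.toLin'_mul, Matrix.toLin'_toMatrix', Matrix.toLin'_apply']
  ext1 i
  ext1
  change f (g' (f _)) = f _
  have h1 : g' (f (Pi.single i 1)) = g (f.rangeRestrict (Pi.single i 1)) := by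
    rw [← hg']; rfl
  have h2 := congrArg Subtype.val (LinearMap.congr_fun hg (f.rangeRestrict (Pi.single i 1)))
  simp only [LinearMap.single_apply]
  rw [h1]
  exact h2

/-- By triangularity, `A - l k` sends column `k` of `V` into the span of the earlier columns, which
the first `k` factors already kill. -/
theorem shiftProd_mul_apply_eq_zero {n : ℕ} {A V S : Matrix (Fin n) (Fin n) ℂ}
    (hV : A * V = V * S) (hS : S.IsUpperTriangular) {l : ℕ → ℂ} (hl : ∀ i, S i i = l i) (k : ℕ)
    (a j : Fin n) (hj : (j : ℕ) < k) : (shiftProd A l k * V) a j = 0 := by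
  induction k generalizing j with
  | zero => omega
  | succ k ih =>
    have h : shiftProd A l (k + 1) * V =
        (shiftProd A l k * V) * (S - l k • (1 : Matrix (Fin n) (Fin n) ℂ)) := by
      rw [shiftProd, mul_assoc, sub_mul, hV, mul_assoc]
      simp [mul_sub]
    rw [h, Matrix.mul_apply]
    refine Finset.sum_eq_zero fun i _ => ?_
    by_cases hi : (i : ℕ) < k
    · rw [ih i hi, zero_mul]
    · rcases eq_or_ne i j with rfl | hij
      · have : (i : ℕ) = k := by omega
        simp [hl, this]
      · have hlt : j < i := by
          rw [Fin.lt_def]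
          have : (i : ℕ) ≠ j := fun h => hij (Fin.ext h)
          omega
        have : S i j = 0 := hS hlt
        simp [this, hij]

/-! ### Schur triangulation in a prescribed order -/

theorem IsSchurDecomposition.mul_eq {n : ℕ} {A V S : Matrix (Fin n) (Fin n) ℂ}
    (h : IsSchurDecomposition A V S) : A * V = V * S := by
  rw [h.eq, mul_assoc, ← Matrix.star_eq_conjTranspose, Matrix.mem_unitaryGroup_iff'.1 h.unitary,
    mul_one]

theorem IsSchurDecomposition.charpoly_eq {n : ℕ} {A V S : Matrix (Fin n) (Fin n) ℂ}
    (h : IsSchurDecomposition A V S) :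
    A.charpoly = ∏ i, (Polynomial.X - Polynomial.C (S i i)) := by
  rw [h.eq, Matrix.charpoly_mul_comm, ← mul_assoc, ← Matrix.star_eq_conjTranspose,
    Matrix.mem_unitaryGroup_iff'.1 h.unitary, one_mul,
    Matrix.charpoly_of_isUpperTriangular _ h.upperTriangular]

theorem exists_eigenvector_of_charpoly_eq_prod {n : ℕ} {A : Matrix (Fin n) (Fin n) ℂ}
    {l : Fin n → ℂ} (hl : A.charpoly = ∏ i, (Polynomial.X - Polynomial.C (l i))) (j : Fin n) :
    ∃ v, v ≠ 0 ∧ A *ᵥ v = l j • v := by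
  have : (Matrix.scalar (Fin n) (l j) - A).det = 0 := by
    rw [← Matrix.eval_charpoly, hl, Polynomial.eval_prod]
    exact Finset.prod_eq_zero (Finset.mem_univ j) (by simp)
  obtain ⟨v, hv, h⟩ := Matrix.exists_mulVec_eq_zero_iff.2 this
  refine ⟨v, hv, ?_⟩
  rw [Matrix.sub_mulVec, sub_eq_zero] at h
  rw [← h]
  simp [Matrix.scalar_apply]

/-- A nonzero vector spans the first column of some unitary matrix. -/
theorem exists_unitary_col_zero {n : ℕ} (v : Fin (n + 1) → ℂ) (hv : v ≠ 0) :
    ∃ Q ∈ Matrix.unitaryGroup (Fin (n + 1)) ℂ, ∃ c : ℂ, ∀ i, Q i 0 = c * v i := by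
  let w : EuclideanSpace ℂ (Fin (n + 1)) := WithLp.toLp 2 v
  have hw : w ≠ 0 := fun h => hv (by simpa [w] using h)
  let u : EuclideanSpace ℂ (Fin (n + 1)) := ((‖w‖⁻¹ : ℝ) : ℂ) • w
  have hu : ‖u‖ = 1 := by
    simp only [u]
    rw [norm_smul]
    simp [norm_ne_zero_iff.2 hw]
  have hon : Orthonormal ℂ (({0} : Set (Fin (n + 1))).domRestrict fun _ => u) := by
    refine ⟨fun _ => hu, ?_⟩
    rintro ⟨i, hi⟩ ⟨j, hj⟩ hij
    exact absurd (Subtype.ext (hi.trans hj.symm)) hij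
  obtain ⟨b, hb⟩ := hon.exists_orthonormalBasis_extension_of_card_eq (by simp)
  refine ⟨(EuclideanSpace.basisFun (Fin (n + 1)) ℂ).toBasis.toMatrix b,
    OrthonormalBasis.toMatrix_orthonormalBasis_mem_unitary _ _, ((‖w‖⁻¹ : ℝ) : ℂ), fun i => ?_⟩
  rw [Module.Basis.toMatrix_apply, hb 0 rfl]
  simp [u, w]

theorem fromBlocks_one_unitary {n : ℕ} {V : Matrix (Fin n) (Fin n) ℂ}
    (hV : V ∈ Matrix.unitaryGroup (Fin n) ℂ) :
    Matrix.of (Fin.cons (Fin.cons 1 0) fun i => Fin.cons 0 (V i)) ∈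
      Matrix.unitaryGroup (Fin (n + 1)) ℂ := by
  rw [Matrix.mem_unitaryGroup_iff] at hV ⊢
  ext i j
  have h := fun i j => congrFun (congrFun hV i) j
  simp only [Matrix.mul_apply, Matrix.star_apply] at h
  simp only [Matrix.mul_apply, Matrix.star_apply, Fin.sum_univ_succ, Matrix.of_apply]
  refine Fin.cases ?_ (fun i => ?_) i <;> refine Fin.cases ?_ (fun j => ?_) j
  · simp
  · simp [(Fin.succ_ne_zero j).symm]
  · simp
  · simpa [Matrix.one_apply] using h i j

/-- Schur triangulation with the eigenvalues in a prescribed order. -/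
theorem exists_isSchurDecomposition {n : ℕ} (A : Matrix (Fin n) (Fin n) ℂ) (l : Fin n → ℂ)
    (hl : A.charpoly = ∏ i, (Polynomial.X - Polynomial.C (l i))) :
    ∃ V S, IsSchurDecomposition A V S ∧ ∀ i, S i i = l i := by
  induction n with
  | zero =>
    refine ⟨1, A, ⟨one_mem _, fun i => i.elim0, by simp⟩, fun i => i.elim0⟩
  | succ n ih =>
    obtain ⟨v, hv, hAv⟩ := exists_eigenvector_of_charpoly_eq_prod hl 0
    obtain ⟨Q, hQ, c, hc⟩ := exists_unitary_col_zero v hv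
    have hQ1 : Qᴴ * Q = 1 := Matrix.mem_unitaryGroup_iff'.1 hQ
    have hQ2 : Q * Qᴴ = 1 := Matrix.mem_unitaryGroup_iff.1 hQ
    -- Deflation: the first column of `Q` is an eigenvector for `l 0`, so the first column of `B` is
    -- zero below its top entry and the lower right block carries the remaining eigenvalues.
    set B := Qᴴ * A * Q with hB
    have hcol : ∀ i, B i 0 = l 0 * (1 : Matrix (Fin (n + 1)) (Fin (n + 1)) ℂ) i 0 := by
      have h1 : ∀ i, (A * Q) i 0 = l 0 * Q i 0 := by
        intro i
        have h := congrFun hAv i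
        simp only [Matrix.mulVec, dotProduct, Pi.smul_apply, smul_eq_mul] at h
        rw [Matrix.mul_apply, hc, mul_left_comm, ← h, Finset.mul_sum]
        exact Finset.sum_congr rfl fun j _ => by rw [hc]; ring
      intro i
      rw [hB, mul_assoc, ← hQ1, Matrix.mul_apply, Matrix.mul_apply, Finset.mul_sum]
      exact Finset.sum_congr rfl fun j _ => by rw [h1]; ring
    have hAB : A = Q * B * Qᴴ := by
      calc A = (Q * Qᴴ) * A * (Q * Qᴴ) := by rw [hQ2]; simp
        _ = _ := by simp only [hB, mul_assoc]
    set B' := B.submatrix Fin.succ Fin.succ with hB'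
    have hchar : B.charpoly = (Polynomial.X - Polynomial.C (l 0)) * B'.charpoly := by
      rw [Matrix.charpoly, Matrix.det_succ_column_zero, Fin.sum_univ_succ,
        Finset.sum_eq_zero fun i _ => ?_]
      · rw [add_zero, Matrix.charmatrix_apply_eq, hcol, Matrix.charpoly]
        simp only [Fin.val_zero, pow_zero, one_mul, Matrix.one_apply_eq, mul_one]
        congr 2
        ext1 i j
        simp [Matrix.charmatrix_apply, Matrix.diagonal_apply, hB']
      · rw [Matrix.charmatrix_apply_ne _ _ _ (Fin.succ_ne_zero i), hcol]
        simp
    have hchar' : B'.charpoly = ∏ i : Fin n, (Polynomial.X - Polynomial.C (l i.succ)) := by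
      have h1 : A.charpoly = B.charpoly := by
        rw [hB, Matrix.charpoly_mul_comm, ← mul_assoc, hQ2, one_mul]
      rw [h1, hchar, Fin.prod_univ_succ] at hl
      exact mul_left_cancel₀ (Polynomial.X_sub_C_ne_zero _) hl
    obtain ⟨V, S, hVS, hSl⟩ := ih B' _ hchar'
    set W : Matrix (Fin (n + 1)) (Fin (n + 1)) ℂ :=
      Matrix.of (Fin.cons (Fin.cons 1 0) fun i => Fin.cons 0 (V i)) with hW
    have hWu := fromBlocks_one_unitary hVS.unitary
    rw [← hW] at hWu
    have hW2 : W * Wᴴ = 1 := Matrix.mem_unitaryGroup_iff.1 hWu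
    have hS : S = Vᴴ * B' * V := by
      have hV1 : Vᴴ * V = 1 := Matrix.mem_unitaryGroup_iff'.1 hVS.unitary
      rw [mul_assoc, hVS.mul_eq, ← mul_assoc, hV1, one_mul]
    have hT0 : ∀ i, (Wᴴ * B * W) i 0 = l 0 * (1 : Matrix (Fin (n + 1)) (Fin (n + 1)) ℂ) i 0 := by
      intro i
      rw [Matrix.mul_apply, Fin.sum_univ_succ]
      have h1 : (Wᴴ * B) i 0 = l 0 * (1 : Matrix (Fin (n + 1)) (Fin (n + 1)) ℂ) i 0 := by
        rw [Matrix.mul_apply, Fin.sum_univ_succ]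
        refine Fin.cases ?_ (fun i => ?_) i <;>
          simp [hcol, hW, Matrix.conjTranspose_apply]
      rw [h1]
      simp [hW]
    have hTs : ∀ i j : Fin n, (Wᴴ * B * W) i.succ j.succ = S i j := by
      intro i j
      rw [hS]
      simp [Matrix.mul_apply, Fin.sum_univ_succ, hW, hB', Matrix.conjTranspose_apply]
    refine ⟨Q * W, Wᴴ * B * W, ⟨mul_mem hQ hWu, ?_, ?_⟩, ?_⟩
    · intro i j hij
      revert hij
      refine Fin.cases (fun hij => ?_) (fun j => ?_) j
      · have hi0 : i ≠ 0 := ne_of_gt hij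
        rw [hT0, Matrix.one_apply_ne hi0, mul_zero]
      · refine Fin.cases (fun hij => absurd hij (Fin.not_lt_zero _)) (fun i hij => ?_) i
        rw [hTs]
        exact hVS.upperTriangular (Fin.succ_lt_succ_iff.1 hij)
    · rw [Matrix.conjTranspose_mul]
      calc A = Q * ((W * Wᴴ) * B * (W * Wᴴ)) * Qᴴ := by rw [hW2, one_mul, mul_one, ← hAB]
        _ = _ := by simp only [mul_assoc]
    · intro i
      refine Fin.cases ?_ (fun i => ?_) i
      · simp [hT0]
      · rw [hTs, hSl]

/-! ### Lipschitz dependence of shifted products -/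

theorem shiftProd_lipschitz {n : ℕ} (A₀ : Matrix (Fin n) (Fin n) ℂ) (s : ℕ → ℂ) (k : ℕ) :
    ∃ C : ℝ, 0 ≤ C ∧ ∀ (A : Matrix (Fin n) (Fin n) ℂ) (l : ℕ → ℂ) (η : ℝ), η ≤ 1 →
      ‖A - A₀‖ ≤ η → (∀ i, ‖l i - s i‖ ≤ η) → ‖shiftProd A l k - shiftProd A₀ s k‖ ≤ C * η := by
  induction k with
  | zero => exact ⟨0, le_rfl, fun A l η _ _ _ => by simp [shiftProd]⟩
  | succ k ih =>
    obtain ⟨C, hC, h⟩ := ih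
    set e := ‖(1 : Matrix (Fin n) (Fin n) ℂ)‖
    set F₀ := A₀ - s k • (1 : Matrix (Fin n) (Fin n) ℂ) with hF₀
    refine ⟨C * (‖F₀‖ + (1 + e)) + ‖shiftProd A₀ s k‖ * (1 + e), by positivity,
      fun A l η hη hA hl => ?_⟩
    have hη0 : 0 ≤ η := (norm_nonneg _).trans hA
    set F := A - l k • (1 : Matrix (Fin n) (Fin n) ℂ) with hF
    have h1 : ‖F - F₀‖ ≤ (1 + e) * η := by
      have : F - F₀ = (A - A₀) - (l k - s k) • (1 : Matrix (Fin n) (Fin n) ℂ) := by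
        rw [hF, hF₀, sub_smul]; abel
      rw [this]
      calc _ ≤ ‖A - A₀‖ + ‖(l k - s k) • (1 : Matrix (Fin n) (Fin n) ℂ)‖ := norm_sub_le _ _
        _ ≤ η + η * e := by
          rw [norm_smul]
          exact add_le_add hA (mul_le_mul_of_nonneg_right (hl k) (norm_nonneg _))
        _ = _ := by ring
    have h2 : ‖F‖ ≤ ‖F₀‖ + (1 + e) := by
      have h3 : ‖F‖ ≤ ‖F₀‖ + ‖F - F₀‖ := by
        simpa using norm_add_le F₀ (F - F₀)
      have h4 : (1 + e) * η ≤ 1 + e := mul_le_of_le_one_right (by positivity) hη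
      linarith
    have h3 : shiftProd A l (k + 1) - shiftProd A₀ s (k + 1) =
        (shiftProd A l k - shiftProd A₀ s k) * F + shiftProd A₀ s k * (F - F₀) := by
      simp only [shiftProd, ← hF, ← hF₀]
      noncomm_ring
    rw [h3]
    calc _ ≤ ‖shiftProd A l k - shiftProd A₀ s k‖ * ‖F‖ + ‖shiftProd A₀ s k‖ * ‖F - F₀‖ :=
          (norm_add_le _ _).trans (add_le_add (norm_mul_le _ _) (norm_mul_le _ _))
      _ ≤ (C * η) * (‖F₀‖ + (1 + e)) + ‖shiftProd A₀ s k‖ * ((1 + e) * η) := by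
          gcongr
          exact h A l η hη hA hl
      _ = _ := by ring

/-! ### Nearly triangular unitary matrices -/

/-- Both sides equal `s.card` minus the mass of the square `s × s`. -/
theorem sum_sum_compl_comm {n : ℕ} (f : Fin n → Fin n → ℝ) (hr : ∀ i, ∑ j, f i j = 1)
    (hc : ∀ j, ∑ i, f i j = 1) (s : Finset (Fin n)) :
    ∑ i ∈ s, ∑ j ∈ sᶜ, f i j = ∑ j ∈ s, ∑ i ∈ sᶜ, f i j := by
  have h1 : ∑ i ∈ s, ∑ j ∈ s, f i j + ∑ i ∈ s, ∑ j ∈ sᶜ, f i j = s.card := by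
    rw [← Finset.sum_add_distrib]
    simp [Finset.sum_add_sum_compl, hr]
  have h2 : ∑ j ∈ s, ∑ i ∈ s, f i j + ∑ j ∈ s, ∑ i ∈ sᶜ, f i j = s.card := by
    rw [← Finset.sum_add_distrib]
    simp [Finset.sum_add_sum_compl, hc]
  rw [Finset.sum_comm] at h2
  linarith

theorem sum_norm_sq_row_of_unitary {n : ℕ} {W : Matrix (Fin n) (Fin n) ℂ}
    (hW : W ∈ Matrix.unitaryGroup (Fin n) ℂ) (i : Fin n) : ∑ j, ‖W i j‖ ^ 2 = 1 := by
  have h := congrFun (congrFun (Matrix.mem_unitaryGroup_iff.1 hW) i) i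
  rw [Matrix.mul_apply, Matrix.one_apply_eq] at h
  have h2 : ((∑ j, ‖W i j‖ ^ 2 : ℝ) : ℂ) = 1 := by
    rw [← h]
    push_cast
    exact Finset.sum_congr rfl fun j _ => by
      rw [Matrix.star_apply]; exact (Complex.mul_conj' _).symm
  exact_mod_cast h2

theorem sum_norm_sq_col_of_unitary {n : ℕ} {W : Matrix (Fin n) (Fin n) ℂ}
    (hW : W ∈ Matrix.unitaryGroup (Fin n) ℂ) (j : Fin n) : ∑ i, ‖W i j‖ ^ 2 = 1 := by
  simpa [Matrix.star_apply] using sum_norm_sq_row_of_unitary (Unitary.star_mem hW) j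

/-- The squared moduli are doubly stochastic, so the block with rows `≤ i` and columns `> i` has the
same mass as its mirror block below the diagonal, at most `n * n * b ^ 2`. -/
theorem norm_apply_le_of_unitary_of_lower {n : ℕ} {W : Matrix (Fin n) (Fin n) ℂ}
    (hW : W ∈ Matrix.unitaryGroup (Fin n) ℂ) {b : ℝ} (hb : 0 ≤ b)
    (h : ∀ i j, j < i → ‖W i j‖ ≤ b) (i j : Fin n) (hij : i ≠ j) : ‖W i j‖ ≤ n * b := by
  have hn : (1 : ℝ) ≤ n := by
    have := i.pos
    exact_mod_cast this
  rcases lt_or_gt_of_ne hij with hlt | hgt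
  · have hsum := sum_sum_compl_comm (fun i j => ‖W i j‖ ^ 2) (sum_norm_sq_row_of_unitary hW)
      (sum_norm_sq_col_of_unitary hW) (Finset.Iic i)
    have h1 : ‖W i j‖ ^ 2 ≤ ∑ i' ∈ Finset.Iic i, ∑ j' ∈ (Finset.Iic i)ᶜ, ‖W i' j'‖ ^ 2 := by
      refine le_trans ?_ (Finset.single_le_sum (f := fun i' => ∑ j' ∈ (Finset.Iic i)ᶜ,
        ‖W i' j'‖ ^ 2) (fun _ _ => Finset.sum_nonneg fun _ _ => by positivity)
        (Finset.mem_Iic.2 le_rfl))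
      exact Finset.single_le_sum (f := fun j' => ‖W i j'‖ ^ 2) (fun _ _ => by positivity)
        (by simpa using hlt)
    have h2 : ∑ j' ∈ Finset.Iic i, ∑ i' ∈ (Finset.Iic i)ᶜ, ‖W i' j'‖ ^ 2 ≤ (n * b) ^ 2 := by
      calc _ ≤ ∑ j' ∈ Finset.Iic i, ∑ i' ∈ (Finset.Iic i)ᶜ, b ^ 2 := by
            refine Finset.sum_le_sum fun j' hj' => Finset.sum_le_sum fun i' hi' => ?_
            have hlt' : j' < i' := by
              simp only [Finset.mem_Iic, Finset.mem_compl, not_le] at hj' hi'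
              exact hj'.trans_lt hi'
            have := h i' j' hlt'
            gcongr
        _ = ((Finset.Iic i).card : ℝ) * (((Finset.Iic i)ᶜ.card : ℝ) * b ^ 2) := by simp
        _ ≤ n * (n * b ^ 2) := by
            have hc : ∀ t : Finset (Fin n), t.card ≤ n := fun t =>
              (Finset.card_le_univ t).trans (by simp)
            gcongr <;> exact hc _
        _ = _ := by ring
    exact le_of_sq_le_sq (h1.trans (hsum.le.trans h2)) (by positivity)
  · exact (h i j hgt).trans (le_mul_of_one_le_left hb hn)

/-- The phases make the diagonal nonnegative. Then `1 - ‖W i i‖ ≤ 1 - ‖W i i‖ ^ 2`, which is the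
off-diagonal mass of column `i`. -/
theorem exists_phase_correction {n : ℕ} {W : Matrix (Fin n) (Fin n) ℂ}
    (hW : W ∈ Matrix.unitaryGroup (Fin n) ℂ) {b : ℝ} (hb : 0 ≤ b)
    (h : ∀ i j, j < i → ‖W i j‖ ≤ b) :
    ∃ d : Fin n → ℂ, (∀ j, ‖d j‖ = 1) ∧
      ∀ i j, ‖(W * Matrix.diagonal d - 1) i j‖ ≤ n ^ 2 * b := by
  have hoff := norm_apply_le_of_unitary_of_lower hW hb h
  have hle : ∀ i j, ‖W i j‖ ≤ 1 := entry_norm_bound_of_unitary hW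
  have hd : ∀ j, ∃ d : ℂ, ‖d‖ = 1 ∧ W j j * d = ‖W j j‖ := by
    intro j
    by_cases h0 : W j j = 0
    · exact ⟨1, by simp, by simp [h0]⟩
    · have h1 : (‖W j j‖ : ℂ) ≠ 0 := by simpa using h0
      refine ⟨starRingEnd ℂ (W j j) / ‖W j j‖, by simp [h0], ?_⟩
      rw [← mul_div_assoc, Complex.mul_conj', div_eq_iff h1, sq]
  choose d hd1 hd2 using hd
  refine ⟨d, hd1, fun i j => ?_⟩
  have hn : (1 : ℝ) ≤ n := by
    have := i.pos
    exact_mod_cast this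
  rw [Matrix.sub_apply, Matrix.mul_diagonal]
  rcases eq_or_ne i j with rfl | hij
  · rw [hd2, Matrix.one_apply_eq]
    have h1 : ‖((‖W i i‖ : ℝ) : ℂ) - 1‖ = 1 - ‖W i i‖ := by
      rw [← Complex.ofReal_one, ← Complex.ofReal_sub, Complex.norm_real, Real.norm_eq_abs,
        abs_of_nonpos (by linarith [hle i i]), neg_sub]
    rw [h1]
    have h2 := Finset.add_sum_erase Finset.univ (fun k => ‖W k i‖ ^ 2) (Finset.mem_univ i)
    rw [sum_norm_sq_col_of_unitary hW] at h2
    have h3 : ∑ k ∈ Finset.univ.erase i, ‖W k i‖ ^ 2 ≤ n * (n * b) := by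
      calc _ ≤ ∑ k ∈ Finset.univ.erase i, (n * b) := by
            refine Finset.sum_le_sum fun k hk => ?_
            refine le_trans ?_ (hoff k i (Finset.ne_of_mem_erase hk))
            exact pow_le_of_le_one (norm_nonneg _) (hle _ _) two_ne_zero
        _ = ((Finset.univ.erase i).card : ℝ) * (n * b) := by simp
        _ ≤ n * (n * b) := by
            gcongr
            exact (Finset.card_le_univ _).trans (by simp)
    have h4 : ‖W i i‖ ^ 2 ≤ ‖W i i‖ := pow_le_of_le_one (norm_nonneg _) (hle _ _) two_ne_zero
    have h5 : ‖W i i‖ ^ 2 + ∑ k ∈ Finset.univ.erase i, ‖W k i‖ ^ 2 = 1 := h2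
    nlinarith
  · rw [Matrix.one_apply_ne hij, sub_zero, norm_mul, hd1, mul_one]
    refine (hoff i j hij).trans ?_
    nlinarith [mul_nonneg (sub_nonneg.2 hn) (mul_nonneg (zero_le_one.trans hn) hb)]

/-! ### Norm comparisons and the kernel at a non-derogatory matrix -/

theorem Matrix.norm_le_of_entry_le (n : ℕ) : ∃ S : ℝ, 0 ≤ S ∧
    ∀ (M : Matrix (Fin n) (Fin n) ℂ) (b : ℝ), (∀ i j, ‖M i j‖ ≤ b) → ‖M‖ ≤ S * b := by
  refine ⟨∑ i : Fin n, ∑ j : Fin n, ‖Matrix.single i j (1 : ℂ)‖,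
    Finset.sum_nonneg (s := Finset.univ) fun _ _ => Finset.sum_nonneg (s := Finset.univ) fun _ _ => norm_nonneg _, fun M b h => ?_⟩
  have hM : M = ∑ i, ∑ j, M i j • Matrix.single i j (1 : ℂ) := by
    conv_lhs => rw [Matrix.matrix_eq_sum_single M]
    simp [Matrix.smul_single]
  rw [hM, Finset.sum_mul]
  refine (norm_sum_le _ _).trans (Finset.sum_le_sum fun i _ => ?_)
  rw [Finset.sum_mul]
  refine (norm_sum_le _ _).trans (Finset.sum_le_sum fun j _ => ?_)
  rw [norm_smul, mul_comm]
  exact mul_le_mul_of_nonneg_left (h i j) (norm_nonneg _)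

theorem Matrix.norm_entry_le_norm {n : ℕ} (M : Matrix (Fin n) (Fin n) ℂ) (i j : Fin n) :
    ‖M i j‖ ≤ ‖M‖ := by
  have h := Matrix.l2_opNorm_mulVec M (EuclideanSpace.single j 1)
  rw [PiLp.norm_single, norm_one, mul_one] at h
  refine le_trans ?_ h
  refine le_trans (le_of_eq ?_) (PiLp.norm_apply_le _ i)
  simp

theorem norm_le_one_of_unitary {n : ℕ} {U : Matrix (Fin n) (Fin n) ℂ}
    (hU : U ∈ Matrix.unitaryGroup (Fin n) ℂ) : ‖U‖ ≤ 1 := by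
  rcases subsingleton_or_nontrivial (Matrix (Fin n) (Fin n) ℂ)
  · rw [Subsingleton.elim U 0, norm_zero]
    exact zero_le_one
  · exact (CStarRing.norm_of_mem_unitary hU).le

/-- The kernel of `shiftProd` at a non-derogatory matrix is spanned by the first Schur vectors. -/
theorem IsSchurDecomposition.apply_eq_zero_of_shiftProd {n : ℕ}
    {A U T : Matrix (Fin n) (Fin n) ℂ} (h : IsSchurDecomposition A U T) (hA : IsNonderogatory A)
    {l : ℕ → ℂ} (hl : ∀ i, T i i = l i) (k : ℕ) (y : Fin n → ℂ) (hy : shiftProd A l k *ᵥ y = 0)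
    (i : Fin n) (hi : k ≤ i) : (Uᴴ *ᵥ y) i = 0 := by
  have hUU : Uᴴ * U = 1 := Matrix.mem_unitaryGroup_iff'.1 h.unitary
  have hk : k ≤ n := hi.trans i.2.le
  let u : Fin k → Fin n → ℂ := fun j => U.col (Fin.castLE hk j)
  have hUu : ∀ j, Uᴴ *ᵥ u j = Pi.single (Fin.castLE hk j) 1 := by
    intro j
    change Uᴴ *ᵥ U.col _ = _
    rw [← Matrix.mulVec_single_one U, Matrix.mulVec_mulVec, hUU, Matrix.one_mulVec]
  have hu : LinearIndependent ℂ u := by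
    have : LinearIndependent ℂ (Uᴴ.mulVecLin ∘ u) := by
      have h1 := (Pi.basisFun ℂ (Fin n)).linearIndependent.comp _ (Fin.castLE_injective hk)
      convert h1 using 1
      funext j
      simp [hUu]
    exact this.of_comp
  have hle : Submodule.span ℂ (Set.range u) ≤ LinearMap.ker (shiftProd A l k).mulVecLin := by
    rw [Submodule.span_le]
    rintro _ ⟨j, rfl⟩
    change shiftProd A l k *ᵥ u j = 0
    funext a
    exact shiftProd_mul_apply_eq_zero h.mul_eq h.upperTriangular hl k a (Fin.castLE hk j) j.2
  -- The `k` independent Schur vectors fill a kernel of dimension at most `k`.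
  have heq := Submodule.eq_of_le_of_finrank_le hle (by
    rw [finrank_span_eq_card hu, Fintype.card_fin]
    exact hA.finrank_ker_shiftProd_le l k)
  have hy' : y ∈ Submodule.span ℂ (Set.range u) := by
    rw [heq]; exact hy
  have hle2 : Submodule.span ℂ (Set.range u) ≤
      LinearMap.ker (LinearMap.proj i ∘ₗ Uᴴ.mulVecLin) := by
    rw [Submodule.span_le]
    rintro _ ⟨j, rfl⟩
    change (Uᴴ *ᵥ u j) i = 0
    rw [hUu, Pi.single_eq_of_ne]
    intro hij
    have := congrArg Fin.val hij
    have := j.2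
    simp at *
    omega
  exact hle2 hy'

/-! ### Hölder perturbation of eigenvalues -/

theorem Matrix.exists_charpoly_eq_prod {n : ℕ} (A : Matrix (Fin n) (Fin n) ℂ) :
    ∃ l : Fin n → ℂ, A.charpoly = ∏ i, (Polynomial.X - Polynomial.C (l i)) := by
  have hs := IsAlgClosed.splits A.charpoly
  have hcard : A.charpoly.roots.toList.length = n := by
    rw [Multiset.length_toList, ← hs.natDegree_eq_card_roots, Matrix.charpoly_natDegree_eq_dim,
      Fintype.card_fin]
  refine ⟨fun i => A.charpoly.roots.toList.get (i.cast hcard.symm), ?_⟩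
  conv_lhs => rw [hs.eq_prod_roots_of_monic A.charpoly_monic, ← Multiset.coe_toList A.charpoly.roots,
    Multiset.map_coe, Multiset.prod_coe, ← List.ofFn_get A.charpoly.roots.toList, List.map_ofFn,
    List.prod_ofFn]
  exact (Fintype.prod_equiv (finCongr hcard.symm) _ _ fun i => rfl).symm

/-- The characteristic polynomial of `A₀` is `O(‖A - A₀‖)` at the eigenvalues of `A`. -/
theorem norm_eval_charpoly_le {n : ℕ} (A₀ : Matrix (Fin n) (Fin n) ℂ) :
    ∃ C : ℝ, 0 ≤ C ∧ ∀ (A : Matrix (Fin n) (Fin n) ℂ) (ν : ℂ) (v : Fin n → ℂ), ‖A - A₀‖ ≤ 1 →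
      v ≠ 0 → A *ᵥ v = ν • v → ‖A₀.charpoly.eval ν‖ ≤ C * ‖A - A₀‖ := by
  have hcont : Continuous fun ν : ℂ => ‖(Matrix.scalar (Fin n) ν - A₀).adjugate‖ := by
    refine Continuous.norm (Continuous.matrix_adjugate ?_)
    exact (Continuous.matrix_diagonal (continuous_pi fun _ => continuous_id)).sub continuous_const
  -- This ball contains every eigenvalue of every `A` within distance `1` of `A₀`.
  obtain ⟨C, hC⟩ := (isCompact_closedBall (0 : ℂ) (‖A₀‖ + 1)).bddAbove_image hcont.continuousOn
  refine ⟨max C 0, le_max_right _ _, fun A ν v hA hv h => ?_⟩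
  set w : EuclideanSpace ℂ (Fin n) := WithLp.toLp 2 v with hw
  have hw0 : 0 < ‖w‖ := norm_pos_iff.2 fun h0 => hv (by simpa [hw] using h0)
  have hν : ‖ν‖ ≤ ‖A₀‖ + 1 := by
    have h1 := Matrix.l2_opNorm_mulVec A w
    have h2 : (WithLp.toLp 2 (A *ᵥ w.ofLp) : EuclideanSpace ℂ (Fin n)) = ν • w := by
      simp [hw, h]
    have h3 : ‖ν • w‖ ≤ ‖A‖ * ‖w‖ := by rw [← h2]; exact h1
    rw [norm_smul] at h3
    have h4 : ‖A‖ ≤ ‖A₀‖ + ‖A - A₀‖ := by simpa using norm_add_le A₀ (A - A₀)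
    have := le_of_mul_le_mul_right h3 hw0
    linarith
  have hadj : ‖(Matrix.scalar (Fin n) ν - A₀).adjugate‖ ≤ max C 0 :=
    (hC ⟨ν, by simpa using hν, rfl⟩).trans (le_max_left _ _)
  have h1 : (Matrix.scalar (Fin n) ν - A₀) *ᵥ v = (A - A₀) *ᵥ v := by
    rw [Matrix.sub_mulVec, Matrix.sub_mulVec, h]
    simp [Matrix.scalar_apply]
  -- The adjugate turns `(ν - A₀) v = (A - A₀) v` into an equation for the determinant, with no
  -- inverse of `ν - A₀`.
  have h2 : ((Matrix.scalar (Fin n) ν - A₀).adjugate * (A - A₀)) *ᵥ v =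
      A₀.charpoly.eval ν • v := by
    rw [← Matrix.mulVec_mulVec, ← h1, Matrix.mulVec_mulVec, Matrix.adjugate_mul,
      Matrix.eval_charpoly, Matrix.smul_mulVec, Matrix.one_mulVec]
  have h3 := Matrix.l2_opNorm_mulVec ((Matrix.scalar (Fin n) ν - A₀).adjugate * (A - A₀)) w
  have h4 : ‖A₀.charpoly.eval ν • w‖ ≤
      ‖(Matrix.scalar (Fin n) ν - A₀).adjugate * (A - A₀)‖ * ‖w‖ := by
    rw [show w.ofLp = v from rfl, h2] at h3
    exact h3
  rw [norm_smul] at h4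
  refine (le_of_mul_le_mul_right h4 hw0).trans ((norm_mul_le _ _).trans ?_)
  gcongr

/-- For a tuple whose product polynomial is not the characteristic polynomial of `A₀`, no nearby
tuple lists the eigenvalues of a nearby matrix. -/
theorem exists_charpoly_ne_nhds {n : ℕ} (A₀ : Matrix (Fin n) (Fin n) ℂ) (a : Fin n → ℂ)
    (ha : A₀.charpoly ≠ ∏ i, (Polynomial.X - Polynomial.C (a i))) :
    ∃ ε : ℝ, 0 < ε ∧ ∀ (A : Matrix (Fin n) (Fin n) ℂ) (l : Fin n → ℂ), ‖A - A₀‖ < ε →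
      (∀ i, ‖l i - a i‖ < ε) → A.charpoly ≠ ∏ i, (Polynomial.X - Polynomial.C (l i)) := by
  obtain ⟨z, hz⟩ : ∃ z, A₀.charpoly.eval z ≠ (∏ i, (Polynomial.X - Polynomial.C (a i))).eval z := by
    by_contra! h
    exact ha (Polynomial.funext h)
  have hcont : Continuous fun p : Matrix (Fin n) (Fin n) ℂ × (Fin n → ℂ) =>
      p.1.charpoly.eval z - (∏ i, (Polynomial.X - Polynomial.C (p.2 i))).eval z := by
    simp only [Matrix.eval_charpoly, Polynomial.eval_prod, Polynomial.eval_sub, Polynomial.eval_X,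
      Polynomial.eval_C]
    refine Continuous.sub (Continuous.matrix_det (continuous_const.sub continuous_fst)) ?_
    fun_prop
  have hev := hcont.continuousAt.eventually_ne (x := (A₀, a)) (sub_ne_zero.2 hz)
  obtain ⟨ε, hε, h⟩ := Metric.eventually_nhds_iff.1 hev
  refine ⟨ε, hε, fun A l hA hl heq => ?_⟩
  refine h (y := (A, l)) ?_ (by rw [heq, sub_self])
  rw [Prod.dist_eq]
  refine max_lt (by rwa [dist_eq_norm]) ((dist_pi_lt_iff hε).2 fun i => ?_)
  rw [dist_eq_norm]
  exact hl i

theorem Finite.exists_pos_uniform {ι : Type*} [Finite ι] {P : ι → ℝ → Prop}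
    (hmono : ∀ i x y, x ≤ y → P i y → P i x) (h : ∀ i, ∃ ε, 0 < ε ∧ P i ε) :
    ∃ ε, 0 < ε ∧ ∀ i, P i ε := by
  cases isEmpty_or_nonempty ι
  · exact ⟨1, one_pos, fun i => isEmptyElim i⟩
  · choose f hf hP using h
    obtain ⟨i₀, h₀⟩ := Finite.exists_min f
    exact ⟨f i₀, hf i₀, fun i => hmono i _ _ (h₀ i) (hP i)⟩

theorem exists_eigenvalue_matching {n : ℕ} (hn : 0 < n) (A₀ : Matrix (Fin n) (Fin n) ℂ)
    (s : Fin n → ℂ) (hs : A₀.charpoly = ∏ i, (Polynomial.X - Polynomial.C (s i))) :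
    ∃ C ε : ℝ, 0 ≤ C ∧ 0 < ε ∧ ∀ A : Matrix (Fin n) (Fin n) ℂ, ‖A - A₀‖ < ε →
      ∃ l : Fin n → ℂ, A.charpoly = ∏ i, (Polynomial.X - Polynomial.C (l i)) ∧
        ∀ i, ‖l i - s i‖ ≤ C * ‖A - A₀‖ ^ (1 / (n : ℝ)) := by
  obtain ⟨C, hC, hbound⟩ := norm_eval_charpoly_le A₀
  have hn' : (n : ℝ) ≠ 0 := by exact_mod_cast hn.ne'
  -- Choosing a close `s (φ j)` for each `l j` could give wrong multiplicities. There are finitely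
  -- many `φ`, so one radius excludes all those whose product differs from the characteristic
  -- polynomial of `A₀`.
  obtain ⟨ε, hε, hne⟩ : ∃ ε : ℝ, 0 < ε ∧ ∀ φ : Fin n → Fin n,
      A₀.charpoly ≠ ∏ i, (Polynomial.X - Polynomial.C (s (φ i))) →
      ∀ (A : Matrix (Fin n) (Fin n) ℂ) (l : Fin n → ℂ), ‖A - A₀‖ < ε →
      (∀ i, ‖l i - s (φ i)‖ < ε) → A.charpoly ≠ ∏ i, (Polynomial.X - Polynomial.C (l i)) := by
    refine Finite.exists_pos_uniform (fun φ x y hxy h h0 A l hA hl =>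
      h h0 A l (hA.trans_le hxy) fun i => (hl i).trans_le hxy) fun φ => ?_
    by_cases h0 : A₀.charpoly = ∏ i, (Polynomial.X - Polynomial.C (s (φ i)))
    · exact ⟨1, one_pos, fun h => (h h0).elim⟩
    · obtain ⟨ε, hε, h⟩ := exists_charpoly_ne_nhds A₀ (s ∘ φ) h0
      exact ⟨ε, hε, fun _ => h⟩
  have hsmall : ∀ᶠ δ in nhds (0 : ℝ), C ^ (1 / (n : ℝ)) * δ ^ (1 / (n : ℝ)) < ε := by
    have hc : ContinuousAt (fun δ : ℝ => C ^ (1 / (n : ℝ)) * δ ^ (1 / (n : ℝ))) 0 :=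
      continuousAt_const.mul (Real.continuousAt_rpow_const _ _ (Or.inr (by positivity)))
    refine hc.eventually_lt continuousAt_const ?_
    rw [Real.zero_rpow (by positivity), mul_zero]
    exact hε
  obtain ⟨ε', hε', hsmall⟩ := Metric.eventually_nhds_iff.1 hsmall
  refine ⟨C ^ (1 / (n : ℝ)), min (min ε ε') 1, by positivity, by positivity, fun A hA => ?_⟩
  obtain ⟨l, hl⟩ := A.exists_charpoly_eq_prod
  have hA1 : ‖A - A₀‖ ≤ 1 := (hA.trans_le (min_le_right _ _)).le
  have hAε : ‖A - A₀‖ < ε := hA.trans_le ((min_le_left _ _).trans (min_le_left _ _))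
  have hAε' : ‖A - A₀‖ < ε' := hA.trans_le ((min_le_left _ _).trans (min_le_right _ _))
  have hφ : ∀ j, ∃ i, ‖l j - s i‖ ≤ C ^ (1 / (n : ℝ)) * ‖A - A₀‖ ^ (1 / (n : ℝ)) := by
    intro j
    by_contra! hcon
    obtain ⟨v, hv, hAv⟩ := exists_eigenvector_of_charpoly_eq_prod hl j
    have h1 := hbound A (l j) v hA1 hv hAv
    rw [hs, Polynomial.eval_prod, norm_prod] at h1
    rw [← Real.mul_rpow hC (norm_nonneg _)] at hcon
    have hx : 0 ≤ C * ‖A - A₀‖ := by positivity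
    have h2 : ∏ i : Fin n, (C * ‖A - A₀‖) ^ (1 / (n : ℝ)) < ∏ i, ‖l j - s i‖ := by
      rcases hx.eq_or_lt with h0 | hpos
      · rw [← h0, Real.zero_rpow (by positivity)] at hcon ⊢
        rw [Finset.prod_const, zero_pow (by simpa using hn.ne')]
        exact Finset.prod_pos fun i _ => hcon i
      · exact Finset.prod_lt_prod_of_nonempty (fun i _ => Real.rpow_pos_of_pos hpos _)
          (fun i _ => hcon i) ⟨⟨0, hn⟩, Finset.mem_univ _⟩
    rw [Finset.prod_const, Finset.card_univ, Fintype.card_fin, ← Real.rpow_natCast,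
      ← Real.rpow_mul hx, one_div_mul_cancel hn', Real.rpow_one] at h2
    simp only [Polynomial.eval_sub, Polynomial.eval_X, Polynomial.eval_C] at h1
    linarith
  choose φ hφ using hφ
  have hr : C ^ (1 / (n : ℝ)) * ‖A - A₀‖ ^ (1 / (n : ℝ)) < ε :=
    hsmall (by simpa using hAε')
  have hA₀φ : A₀.charpoly = ∏ i, (Polynomial.X - Polynomial.C (s (φ i))) := by
    by_contra h0
    exact hne φ h0 A l hAε (fun i => (hφ i).trans_lt hr) hl
  have hroots : ∀ t : Fin n → ℂ, (∏ i, (Polynomial.X - Polynomial.C (t i))).roots =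
      Finset.univ.val.map t := by
    intro t
    rw [Polynomial.roots_prod _ _ (Finset.prod_ne_zero_iff.2 fun i _ =>
      Polynomial.X_sub_C_ne_zero _)]
    simp
  have hperm : (Finset.univ.val.map s : Multiset ℂ) = Finset.univ.val.map (s ∘ φ) := by
    rw [← hroots, ← hroots, ← hs, hA₀φ]; rfl
  -- With repeated eigenvalues `φ` need not be a bijection; only the multisets of `s` and `s ∘ φ`
  -- agree, so a permutation is assembled from bijections between their fibres.
  obtain ⟨π, hπ⟩ : ∃ π : Equiv.Perm (Fin n), s = (s ∘ φ) ∘ π := by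
    have hcard : ∀ c, Nonempty ({i // s i = c} ≃ {i // (s ∘ φ) i = c}) := by
      intro c
      refine Fintype.card_eq.1 ?_
      have := congrArg (Multiset.count c) hperm
      rw [Multiset.count_map, Multiset.count_map] at this
      simpa [Fintype.card_subtype, Finset.card, eq_comm] using this
    exact ⟨Equiv.ofFiberEquiv fun c => (hcard c).some, funext fun i =>
      (Equiv.ofFiberEquiv_map _ i).symm⟩
  refine ⟨l ∘ π, ?_, fun i => ?_⟩
  · rw [hl]
    exact (Equiv.prod_comp π fun i => Polynomial.X - Polynomial.C (l i)).symm
  · have := hφ (π i)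
    rwa [show s (φ (π i)) = s i from (congrFun hπ i).symm] at this

/-! ### Perturbation of Schur decompositions -/

theorem diagonal_mem_unitaryGroup {n : ℕ} {d : Fin n → ℂ} (hd : ∀ i, ‖d i‖ = 1) :
    Matrix.diagonal d ∈ Matrix.unitaryGroup (Fin n) ℂ := by
  rw [Matrix.mem_unitaryGroup_iff, Matrix.star_eq_conjTranspose, Matrix.diagonal_conjTranspose,
    Matrix.diagonal_mul_diagonal, ← Matrix.diagonal_one]
  congr 1
  funext i
  change d i * starRingEnd ℂ (d i) = 1
  rw [Complex.mul_conj', hd]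
  simp

/-- Rescaling the Schur vectors by phases gives another Schur decomposition. -/
theorem IsSchurDecomposition.mul_diagonal {n : ℕ} {A V S : Matrix (Fin n) (Fin n) ℂ}
    (h : IsSchurDecomposition A V S) {d : Fin n → ℂ} (hd : ∀ i, ‖d i‖ = 1) :
    IsSchurDecomposition A (V * Matrix.diagonal d)
      ((Matrix.diagonal d)ᴴ * S * Matrix.diagonal d) := by
  have hD := diagonal_mem_unitaryGroup hd
  have hD1 : Matrix.diagonal d * (Matrix.diagonal d)ᴴ = 1 := Matrix.mem_unitaryGroup_iff.1 hD
  refine ⟨mul_mem h.unitary hD, fun i j hij => ?_, ?_⟩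
  · rw [Matrix.mul_diagonal, Matrix.diagonal_conjTranspose, Matrix.diagonal_mul,
      h.upperTriangular hij, mul_zero, zero_mul]
  · rw [Matrix.conjTranspose_mul]
    calc A = V * ((Matrix.diagonal d * (Matrix.diagonal d)ᴴ) * S *
          (Matrix.diagonal d * (Matrix.diagonal d)ᴴ)) * Vᴴ := by
          rw [hD1, one_mul, mul_one, ← h.eq]
      _ = _ := by simp only [mul_assoc]

theorem IsSchurDecomposition.triangular_eq {n : ℕ} {A V S : Matrix (Fin n) (Fin n) ℂ}
    (h : IsSchurDecomposition A V S) : S = Vᴴ * A * V := by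
  have hV : Vᴴ * V = 1 := Matrix.mem_unitaryGroup_iff'.1 h.unitary
  rw [mul_assoc, h.mul_eq, ← mul_assoc, hV, one_mul]

/-- The triangular factor depends Lipschitz continuously on the matrix and the unitary factor. -/
theorem IsSchurDecomposition.norm_triangular_sub_le {n : ℕ}
    {A A₀ U U₀ T T₀ : Matrix (Fin n) (Fin n) ℂ} (h : IsSchurDecomposition A U T)
    (h₀ : IsSchurDecomposition A₀ U₀ T₀) :
    ‖T - T₀‖ ≤ (‖A‖ + ‖A₀‖) * ‖U - U₀‖ + ‖A - A₀‖ := by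
  have hU := norm_le_one_of_unitary h.unitary
  have hU₀ : ‖U₀ᴴ‖ ≤ 1 := norm_le_one_of_unitary (Unitary.star_mem h₀.unitary)
  have heq : T - T₀ = (U - U₀)ᴴ * A * U + U₀ᴴ * (A - A₀) * U + U₀ᴴ * A₀ * (U - U₀) := by
    rw [h.triangular_eq, h₀.triangular_eq, Matrix.conjTranspose_sub]
    noncomm_ring
  have h1 : ‖(U - U₀)ᴴ * A * U‖ ≤ ‖U - U₀‖ * ‖A‖ := by
    refine (norm_mul_le _ _).trans ((mul_le_of_le_one_right (norm_nonneg _) hU).trans ?_)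
    refine (norm_mul_le _ _).trans ?_
    rw [Matrix.l2_opNorm_conjTranspose]
  have h2 : ‖U₀ᴴ * (A - A₀) * U‖ ≤ ‖A - A₀‖ := by
    refine (norm_mul_le _ _).trans ((mul_le_of_le_one_right (norm_nonneg _) hU).trans ?_)
    exact (norm_mul_le _ _).trans (mul_le_of_le_one_left (norm_nonneg _) hU₀)
  have h3 : ‖U₀ᴴ * A₀ * (U - U₀)‖ ≤ ‖A₀‖ * ‖U - U₀‖ := by
    refine (norm_mul_le _ _).trans (mul_le_mul_of_nonneg_right ?_ (norm_nonneg _))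
    exact (norm_mul_le _ _).trans (mul_le_of_le_one_left (norm_nonneg _) hU₀)
  rw [heq]
  refine (norm_add₃_le).trans ?_
  linarith

/-- Schur vectors are Lipschitz continuous in the matrix together with its ordered eigenvalues. -/
theorem IsNonderogatory.exists_schur_lipschitz {n : ℕ} {A₀ : Matrix (Fin n) (Fin n) ℂ}
    (hA₀ : IsNonderogatory A₀) (s : Fin n → ℂ) :
    ∃ C : ℝ, 0 ≤ C ∧ ∀ U₀ T₀ : Matrix (Fin n) (Fin n) ℂ, IsSchurDecomposition A₀ U₀ T₀ →
      (∀ i, T₀ i i = s i) → ∀ (A : Matrix (Fin n) (Fin n) ℂ) (l : Fin n → ℂ) (η : ℝ),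
      A.charpoly = ∏ i, (Polynomial.X - Polynomial.C (l i)) → η ≤ 1 → ‖A - A₀‖ ≤ η →
      (∀ i, ‖l i - s i‖ ≤ η) →
      ∃ U T : Matrix (Fin n) (Fin n) ℂ, IsSchurDecomposition A U T ∧ ‖U - U₀‖ ≤ C * η := by
  -- The padding value is immaterial: only products of at most `n` factors are used.
  let ext : (Fin n → ℂ) → ℕ → ℂ := fun l k => if h : k < n then l ⟨k, h⟩ else 0
  have hext : ∀ (l : Fin n → ℂ) (i : Fin n), ext l i = l i := fun l i => by simp [ext]
  choose C hC hLip using fun k => shiftProd_lipschitz A₀ (ext s) k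
  choose G hG using fun k => Matrix.exists_mul_mul_eq_self (shiftProd A₀ (ext s) k)
  obtain ⟨S, hS, hSn⟩ := Matrix.norm_le_of_entry_le n
  set B := ∑ j : Fin n, ‖G (j + 1)‖ * C (j + 1) with hB
  have hB0 : 0 ≤ B := Finset.sum_nonneg fun j _ => mul_nonneg (norm_nonneg _) (hC _)
  refine ⟨S * (n ^ 2 * B), by positivity, fun U₀ T₀ h₀ hs A l η hl hη hA hls => ?_⟩
  have hη0 : 0 ≤ η := (norm_nonneg _).trans hA
  obtain ⟨V, R, hV, hR⟩ := exists_isSchurDecomposition A l hl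
  have hU₀' : U₀ᴴ ∈ Matrix.unitaryGroup (Fin n) ℂ := Unitary.star_mem h₀.unitary
  have hlow : ∀ i j, j < i → ‖(U₀ᴴ * V) i j‖ ≤ B * η := by
    intro i j hij
    -- Column `j` needs `j + 1` factors to be killed, and the kernel of `M` then has no component in
    -- rows `i > j`.
    set M := shiftProd A₀ (ext s) (j + 1)
    set N := shiftProd A (ext l) (j + 1)
    set Gj := G (j + 1)
    have h1 : (U₀ᴴ * V) i j = (U₀ᴴ * (Gj * (M - N)) * V) i j := by
      have hker : M *ᵥ ((V - Gj * M * V).col j) = 0 := by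
        rw [← Matrix.mulVec_single_one, Matrix.mulVec_mulVec, mul_sub, ← mul_assoc, ← mul_assoc,
          hG, sub_self, Matrix.zero_mulVec]
      have h2 := h₀.apply_eq_zero_of_shiftProd hA₀ (l := ext s) (fun i => by rw [hs, hext]) _ _
        hker i hij
      rw [← Matrix.mulVec_single_one, Matrix.mulVec_mulVec, Matrix.mulVec_single_one] at h2
      change (U₀ᴴ * (V - Gj * M * V)) i j = 0 at h2
      have h3 : (U₀ᴴ * Gj * (N * V)) i j = 0 := by
        rw [Matrix.mul_apply]
        refine Finset.sum_eq_zero fun a _ => ?_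
        rw [shiftProd_mul_apply_eq_zero hV.mul_eq hV.upperTriangular
          (fun i => by rw [hR, hext]) _ a j (Nat.lt_succ_self _), mul_zero]
      have h4 : U₀ᴴ * V = U₀ᴴ * (Gj * (M - N)) * V + U₀ᴴ * (V - Gj * M * V) +
          U₀ᴴ * Gj * (N * V) := by noncomm_ring
      conv_lhs => rw [h4]
      rw [Matrix.add_apply, Matrix.add_apply, h2, h3, add_zero, add_zero]
    rw [h1]
    calc _ ≤ ‖U₀ᴴ * (Gj * (M - N)) * V‖ := Matrix.norm_entry_le_norm _ _ _
      _ ≤ ‖Gj * (M - N)‖ := by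
        refine (norm_mul_le _ _).trans
          ((mul_le_of_le_one_right (norm_nonneg _) (norm_le_one_of_unitary hV.unitary)).trans ?_)
        exact (norm_mul_le _ _).trans
          (mul_le_of_le_one_left (norm_nonneg _) (norm_le_one_of_unitary hU₀'))
      _ ≤ ‖Gj‖ * (C (j + 1) * η) := by
        refine (norm_mul_le _ _).trans (mul_le_mul_of_nonneg_left ?_ (norm_nonneg _))
        rw [norm_sub_rev]
        refine hLip _ A (ext l) η hη hA fun k => ?_
        by_cases hk : k < n
        · simpa [ext, hk] using hls ⟨k, hk⟩
        · simpa [ext, hk] using hη0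
      _ ≤ B * η := by
        rw [← mul_assoc]
        refine mul_le_mul_of_nonneg_right ?_ hη0
        exact Finset.single_le_sum (f := fun j : Fin n => ‖G (j + 1)‖ * C (j + 1))
          (fun j _ => mul_nonneg (norm_nonneg _) (hC _)) (Finset.mem_univ j)
  obtain ⟨d, hd, hWd⟩ := exists_phase_correction (mul_mem hU₀' hV.unitary)
    (mul_nonneg hB0 hη0) hlow
  refine ⟨_, _, hV.mul_diagonal hd, ?_⟩
  have h5 : V * Matrix.diagonal d - U₀ = U₀ * (U₀ᴴ * V * Matrix.diagonal d - 1) := by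
    have : U₀ * U₀ᴴ = 1 := Matrix.mem_unitaryGroup_iff.1 h₀.unitary
    rw [mul_sub, mul_one, ← mul_assoc, ← mul_assoc, this, one_mul]
  rw [h5]
  refine (norm_mul_le _ _).trans
    ((mul_le_of_le_one_left (norm_nonneg _) (norm_le_one_of_unitary h₀.unitary)).trans ?_)
  refine (hSn _ _ hWd).trans (le_of_eq (by ring))

/-- The Schur perturbation bound for Schur decompositions with a fixed ordering of eigenvalues. -/
theorem IsNonderogatory.exists_schur_holder_of_diag {n : ℕ} (hn : 0 < n)
    {A₀ : Matrix (Fin n) (Fin n) ℂ} (hA₀ : IsNonderogatory A₀) (s : Fin n → ℂ)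
    (hs : A₀.charpoly = ∏ i, (Polynomial.X - Polynomial.C (s i))) :
    ∃ K ε : ℝ, 0 < K ∧ 0 < ε ∧
      ∀ U₀ T₀ : Matrix (Fin n) (Fin n) ℂ, IsSchurDecomposition A₀ U₀ T₀ → (∀ i, T₀ i i = s i) →
        ∀ A : Matrix (Fin n) (Fin n) ℂ, ‖A - A₀‖ < ε →
          ∃ U T : Matrix (Fin n) (Fin n) ℂ, IsSchurDecomposition A U T ∧
            ‖U - U₀‖ + ‖T - T₀‖ ≤ K * ‖A - A₀‖ ^ (1 / (n : ℝ)) := by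
  obtain ⟨C, hC, hLip⟩ := hA₀.exists_schur_lipschitz s
  obtain ⟨C₁, ε₁, hC₁, hε₁, hmatch⟩ := exists_eigenvalue_matching hn A₀ s hs
  -- With `C₂ ≥ 1`, `η = C₂ * θ` bounds both the matrix and the eigenvalue error; the radius `C₂⁻¹ ^
  -- n` ensures `η ≤ 1`.
  set C₂ := C₁ + 1 with hC₂
  have hC₂1 : 1 ≤ C₂ := by linarith
  have hC₂0 : 0 < C₂ := by linarith
  refine ⟨(1 + (‖A₀‖ + 1 + ‖A₀‖)) * (C * C₂) + 1, min ε₁ ((C₂⁻¹) ^ n), by positivity,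
    by positivity, fun U₀ T₀ h₀ hT₀ A hA => ?_⟩
  obtain ⟨l, hl, hls⟩ := hmatch A (hA.trans_le (min_le_left _ _))
  have hAC : ‖A - A₀‖ ≤ (C₂⁻¹) ^ n := (hA.trans_le (min_le_right _ _)).le
  have hinv : C₂⁻¹ ≤ 1 := inv_le_one_of_one_le₀ hC₂1
  have hA1 : ‖A - A₀‖ ≤ 1 := hAC.trans (pow_le_one₀ (by positivity) hinv)
  set θ := ‖A - A₀‖ ^ (1 / (n : ℝ)) with hθ
  have hθ0 : 0 ≤ θ := by positivity
  have hθC : θ ≤ C₂⁻¹ := by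
    calc θ ≤ ((C₂⁻¹) ^ n) ^ (1 / (n : ℝ)) :=
          Real.rpow_le_rpow (norm_nonneg _) hAC (by positivity)
      _ = C₂⁻¹ := by rw [one_div, Real.pow_rpow_inv_natCast (by positivity) hn.ne']
  have hAθ : ‖A - A₀‖ ≤ θ := by
    refine Real.self_le_rpow_of_le_one (norm_nonneg _) hA1 ?_
    rw [div_le_one (by exact_mod_cast hn)]
    exact_mod_cast hn
  have hη : C₂ * θ ≤ 1 := by
    calc C₂ * θ ≤ C₂ * C₂⁻¹ := by gcongr
      _ = 1 := mul_inv_cancel₀ hC₂0.ne'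
  obtain ⟨U, T, hUT, hU⟩ := hLip U₀ T₀ h₀ hT₀ A l (C₂ * θ) hl hη
    (hAθ.trans (le_mul_of_one_le_left hθ0 hC₂1))
    (fun i => (hls i).trans (mul_le_mul_of_nonneg_right (by linarith) hθ0))
  refine ⟨U, T, hUT, ?_⟩
  have hT := hUT.norm_triangular_sub_le h₀
  have hAn : ‖A‖ ≤ ‖A₀‖ + 1 := by
    have : ‖A‖ ≤ ‖A₀‖ + ‖A - A₀‖ := by simpa using norm_add_le A₀ (A - A₀)
    linarith
  calc ‖U - U₀‖ + ‖T - T₀‖ ≤ ‖U - U₀‖ + ((‖A‖ + ‖A₀‖) * ‖U - U₀‖ + ‖A - A₀‖) := by gcongr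
    _ ≤ C * (C₂ * θ) + ((‖A₀‖ + 1 + ‖A₀‖) * (C * (C₂ * θ)) + θ) := by gcongr
    _ = _ := by ring

theorem theorem1p2 (n : ℕ) (hn : 0 < n) (A₀ : Matrix (Fin n) (Fin n) ℂ)
    (hA₀ : IsNonderogatory A₀) :
    ∃ K ε : ℝ, 0 < K ∧ 0 < ε ∧
      ∀ U₀ T₀ : Matrix (Fin n) (Fin n) ℂ, IsSchurDecomposition A₀ U₀ T₀ →
        ∀ A : Matrix (Fin n) (Fin n) ℂ, ‖A - A₀‖ < ε →
          ∃ U T : Matrix (Fin n) (Fin n) ℂ, IsSchurDecomposition A U T ∧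
            ‖U - U₀‖ + ‖T - T₀‖ ≤ K * ‖A - A₀‖ ^ (1 / (n : ℝ)) := by
  obtain ⟨s, hs⟩ := A₀.exists_charpoly_eq_prod
  have hroots : ∀ (t : Fin n → ℂ), A₀.charpoly = ∏ i, (Polynomial.X - Polynomial.C (t i)) →
      ∀ i, ∃ j, s j = t i := by
    intro t ht i
    have h : A₀.charpoly.eval (t i) = 0 := by
      rw [ht, Polynomial.eval_prod]
      exact Finset.prod_eq_zero (Finset.mem_univ i) (by simp)
    rw [hs, Polynomial.eval_prod, Finset.prod_eq_zero_iff] at h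
    obtain ⟨j, -, hj⟩ := h
    exact ⟨j, by simpa [sub_eq_zero, eq_comm] using hj⟩
  -- Taking `δ` as radius and `δ⁻¹` as constant leaves one parameter, and the statement persists as
  -- `δ` shrinks. An ordering that is not a valid list of the eigenvalues of `A₀` is vacuous.
  have hφ : ∀ φ : Fin n → Fin n, ∃ δ : ℝ, 0 < δ ∧
      ∀ U₀ T₀ : Matrix (Fin n) (Fin n) ℂ, IsSchurDecomposition A₀ U₀ T₀ →
        (∀ i, T₀ i i = s (φ i)) → ∀ A : Matrix (Fin n) (Fin n) ℂ, ‖A - A₀‖ < δ →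
          ∃ U T : Matrix (Fin n) (Fin n) ℂ, IsSchurDecomposition A U T ∧
            ‖U - U₀‖ + ‖T - T₀‖ ≤ δ⁻¹ * ‖A - A₀‖ ^ (1 / (n : ℝ)) := by
    intro φ
    by_cases h : A₀.charpoly = ∏ i, (Polynomial.X - Polynomial.C (s (φ i)))
    · obtain ⟨K, ε, hK, hε, hKε⟩ := hA₀.exists_schur_holder_of_diag hn (s ∘ φ) h
      refine ⟨min ε K⁻¹, by positivity, fun U₀ T₀ h₀ hT₀ A hA => ?_⟩
      obtain ⟨U, T, hUT, hle⟩ := hKε U₀ T₀ h₀ hT₀ A (hA.trans_le (min_le_left _ _))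
      refine ⟨U, T, hUT, hle.trans (mul_le_mul_of_nonneg_right ?_ (by positivity))⟩
      exact le_inv_of_le_inv₀ (by positivity) (min_le_right _ _)
    · refine ⟨1, one_pos, fun U₀ T₀ h₀ hT₀ => (h ?_).elim⟩
      rw [h₀.charpoly_eq]
      simp [hT₀]
  obtain ⟨δ, hδ, hall⟩ := Finite.exists_pos_uniform (ι := Fin n → Fin n)
    (P := fun φ δ => 0 < δ → ∀ U₀ T₀ : Matrix (Fin n) (Fin n) ℂ, IsSchurDecomposition A₀ U₀ T₀ →
        (∀ i, T₀ i i = s (φ i)) → ∀ A : Matrix (Fin n) (Fin n) ℂ, ‖A - A₀‖ < δ →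
          ∃ U T : Matrix (Fin n) (Fin n) ℂ, IsSchurDecomposition A U T ∧
            ‖U - U₀‖ + ‖T - T₀‖ ≤ δ⁻¹ * ‖A - A₀‖ ^ (1 / (n : ℝ)))
    (fun φ x y hxy h hx U₀ T₀ h₀ hT₀ A hA => by
      obtain ⟨U, T, hUT, hle⟩ := h (hx.trans_le hxy) U₀ T₀ h₀ hT₀ A (hA.trans_le hxy)
      exact ⟨U, T, hUT, hle.trans (by gcongr)⟩)
    (fun φ => by
      obtain ⟨δ, hδ, h⟩ := hφ φ
      exact ⟨δ, hδ, fun _ => h⟩)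
  refine ⟨δ⁻¹, δ, by positivity, hδ, fun U₀ T₀ h₀ A hA => ?_⟩
  choose φ hφ' using hroots (fun i => T₀ i i) h₀.charpoly_eq
  exact hall φ hδ U₀ T₀ h₀ (fun i => (hφ' i).symm) A hA
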